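/- Let $1\le k\le n$ be integers, let $\mathcal Y=\{1,\dots,n\}$, let $\Delta_{\mathcal Y}$ be the set of probability distributions on $\mathcal Y$, and let $\mathcal R_k$ be the set of subsets of $\mathcal Y$ of size exactly $k$. For $u\in\mathbb R^n$ let $u_{[i]}$ be the $i$-th largest entry of $u$, let $e_y$ be the $y$-th standard basis vector, and let $[x]_+=\max(x,0)$. The top-$k$ loss is $\ell_k(S,y)=\mathbb 1\{y\notin S\}$ for $S\in\mathcal R_k$, and $$L_3(u,y)=\frac1k\sum_{i=1}^k\bigl[\,1-u_y+(u-e_y)_{[i]}\,\bigr]_+ ,\qquad u\in\mathbb R^n,\ y\in\mathcal Y .$$ Let $\psi_k:\mathbb R^n\to\mathcal R_k$ be an argmax link, i.e. any map with $\psi_k(u)\in\arg\max_{S\in\mathcal R_k}\sum_{i\in S}u_i$ for all $u$ (ties broken arbitrarily). Put $$\mathcal P^{(3)}=\Bigl\{p\in\Delta_{\mathcal Y}\ :\ p_{[k]}>\tfrac1{k+1}\ \text{ and }\ \tfrac{\sum_{i=k+1}^n p_{[i]}}{k-1}\le p_{[k]}\Bigr\},$$ where the second condition is omitted if $k=1$.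 Then $(L_3,\psi_k)$ is consistent (calibrated) with respect to $\ell_k$ on $\mathcal P^{(3)}$: for every $p\in\mathcal P^{(3)}$, $$\inf_{u\in\mathbb R^n:\ \psi_k(u)\notin\gamma_k(p)}\ \mathbb E_{Y\sim p}L_3(u,Y)\;>\;\inf_{u\in\mathbb R^n}\ \mathbb E_{Y\sim p}L_3(u,Y),$$ where $\gamma_k(p)=\arg\min_{S\in\mathcal R_k}\mathbb E_{Y\sim p}\,\ell_k(S,Y)$ and the infimum over the empty set is $+\infty$. -/

import Mathlib

noncomputable section

namespace TopK

/-- Expected loss `𝔼_{Y ∼ p} L(r, Y)` for a distribution `p` on the labels `Fin n`. -/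
def expectedLoss {n : ℕ} {R : Type*} (L : R → Fin n → ℝ) (p : Fin n → ℝ) (r : R) : ℝ :=
  ∑ y, p y * L r y

/-- The property elicited by `L`: the set of reports minimizing the expected loss under `p`. -/
def prop {n : ℕ} {R : Type*} (L : R → Fin n → ℝ) (p : Fin n → ℝ) : Set R :=
  {r | ∀ r' : R, expectedLoss L p r ≤ expectedLoss L p r'}

/-- `(L, ψ)` is calibrated with respect to `ℓ` over `P`. The infima are taken in the extended
reals, so that the infimum over an empty set of reports is `+∞`. -/
def Calibrated {n d : ℕ} {R : Type*} (L : (Fin d → ℝ) → Fin n → ℝ) (ψ : (Fin d → ℝ) → R)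
    (ℓ : R → Fin n → ℝ) (P : Set (Fin n → ℝ)) : Prop :=
  ∀ p ∈ P,
    (⨅ u : Fin d → ℝ, (expectedLoss L p u : EReal)) <
      ⨅ u ∈ {u : Fin d → ℝ | ψ u ∉ prop ℓ p}, (expectedLoss L p u : EReal)

/-- The reports of top-`k` classification: sets of exactly `k` labels. -/
abbrev Report (n k : ℕ) : Type := {S : Finset (Fin n) // S.card = k}

/-- Top-`k` loss: `1` if the label is not in the reported set and `0` otherwise. -/
def topKLoss {n k : ℕ} (S : Report n k) (y : Fin n) : ℝ :=
  if y ∈ S.1 then 0 else 1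

/-- `T_k(u)`: the size-`k` sets of labels that maximize the sum of the entries of `u`. -/
def topSets {n : ℕ} (k : ℕ) (u : Fin n → ℝ) : Set (Report n k) :=
  {S | ∀ S' : Report n k, ∑ i ∈ S'.1, u i ≤ ∑ i ∈ S.1, u i}

/-- An argmax link: it selects, with arbitrary tie-breaking, a top-`k` set of `u`. -/
def IsArgmaxLink {n k : ℕ} (ψ : (Fin n → ℝ) → Report n k) : Prop :=
  ∀ u, ψ u ∈ topSets k u

/-- The entries of `u` in decreasing order; `sortedDesc u i` is the `(i+1)`-st largest entry
`u_[i+1]`, as `i : Fin n` counts from `0`. -/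
def sortedDesc {n : ℕ} (u : Fin n → ℝ) (i : Fin n) : ℝ :=
  u (Tuple.sort (fun j => -u j) i)

/-- The surrogate `L₃(u, y) = (1/k) ∑_{i=1}^k [1 - u_y + (u - e_y)_[i]]_+`. -/
def L3 {n : ℕ} (k : ℕ) (u : Fin n → ℝ) (y : Fin n) : ℝ :=
  (1 / (k : ℝ)) * ∑ i ∈ Finset.univ.filter (fun i : Fin n => (i : ℕ) < k),
    max (1 - u y + sortedDesc (u - Pi.single y 1) i) 0

/-- The distributions `p` on `n` labels with `p_[k] > 1/(k+1)` and, where the quotient makes sense,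
`(∑_{i=k+1}^n p_[i]) / (k-1) ≤ p_[k]`. -/
def P3 (n k : ℕ) (hk : 1 ≤ k) (hkn : k ≤ n) : Set (Fin n → ℝ) :=
  {p | p ∈ stdSimplex ℝ (Fin n) ∧
    1 / ((k : ℝ) + 1) < sortedDesc p ⟨k - 1, by omega⟩ ∧
    (2 ≤ k →
      (∑ i ∈ Finset.univ.filter (fun i : Fin n => k ≤ (i : ℕ)), sortedDesc p i) / ((k : ℝ) - 1)
        ≤ sortedDesc p ⟨k - 1, by omega⟩)}

end TopK

end

/-!
If an argmax link reports a suboptimal set `S` at `u`, some label `i` of probability at least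
`p_[k]` is missing from `S`, and all `k` labels of `S` score at least as high as `i`. Raise `u i`
by `1`. The `k` hinge terms that make up `k L₃(u, i)` were all at least `1`, so each drops by `1`,
while `k L₃(u, y)` grows by at most `1` for every other label `y`. Thus `k` times the expected
loss drops by at least `k p_i - (1 - p_i) ≥ (k + 1) p_[k] - 1 > 0`, a gap which does not depend
on `u`.
-/

namespace TopK

open Finset

theorem sum_le_sum_of_card_eq {ι M : Type*} [DecidableEq ι] [AddCommMonoid M] [PartialOrder M]
    [IsOrderedCancelAddMonoid M] {f : ι → M} {s t : Finset ι} (hcard : #s = #t)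
    (h : ∀ i ∈ s \ t, ∀ j ∈ t \ s, f i ≤ f j) : ∑ i ∈ s, f i ≤ ∑ i ∈ t, f i := by
  rw [← sum_sdiff_le_sum_sdiff]
  let e : ↥(s \ t) ≃ ↥(t \ s) := equivOfCardEq (card_sdiff_comm hcard)
  calc ∑ i ∈ s \ t, f i
      = ∑ i : ↥(s \ t), f i := (sum_coe_sort _ _).symm
    _ ≤ ∑ i : ↥(s \ t), f (e i) := sum_le_sum fun i _ => h i i.2 (e i) (e i).2
    _ = ∑ j : ↥(t \ s), f j := e.sum_comp fun j => f j
    _ = ∑ j ∈ t \ s, f j := sum_coe_sort _ _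

theorem sum_le_sum_val_lt_of_antitone {M : Type*} [AddCommMonoid M] [PartialOrder M]
    [IsOrderedCancelAddMonoid M] {n k : ℕ} {f : Fin n → M} (hf : Antitone f) (hf₀ : ∀ i, 0 ≤ f i)
    {S : Finset (Fin n)} (hS : #S ≤ k) :
    ∑ i ∈ S, f i ≤ ∑ i with i.val < k, f i := by
  have hcard : #S ≤ #{i : Fin n | i.val < k} := by
    rw [Fin.card_filter_val_lt]
    exact le_min (card_le_univ S |>.trans_eq (Fintype.card_fin n)) hS
  obtain ⟨S', hSS', hS'⟩ := exists_superset_card_eq hcard (card_le_univ _)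
  calc ∑ i ∈ S, f i
      ≤ ∑ i ∈ S', f i := sum_le_sum_of_subset_of_nonneg hSS' fun i _ _ => hf₀ i
    _ ≤ ∑ i with i.val < k, f i := sum_le_sum_of_card_eq hS' fun i hi j hj => hf <| by
        simp only [mem_sdiff, mem_filter, mem_univ, true_and, not_lt] at hi hj
        exact Fin.le_def.mpr (hj.1.le.trans hi.2)

theorem calibrated_of_forall_exists_add_le {n d : ℕ} {R : Type*}
    {L : (Fin d → ℝ) → Fin n → ℝ} {ψ : (Fin d → ℝ) → R} {ℓ : R → Fin n → ℝ}
    {P : Set (Fin n → ℝ)}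
    (hbdd : ∀ p ∈ P, BddBelow (Set.range (expectedLoss L p)))
    (hgap : ∀ p ∈ P, ∃ δ > 0, ∀ u, ψ u ∉ prop ℓ p →
      ∃ u', expectedLoss L p u' + δ ≤ expectedLoss L p u) :
    Calibrated L ψ ℓ P := by
  intro p hp
  obtain ⟨δ, hδ, himprove⟩ := hgap p hp
  obtain ⟨v, hv⟩ := exists_lt_of_ciInf_lt (lt_add_of_pos_right (⨅ u, expectedLoss L p u) hδ)
  refine (iInf_le _ v).trans_lt ((EReal.coe_lt_coe_iff.mpr hv).trans_le ?_)
  refine le_iInf₂ fun u hu => EReal.coe_le_coe_iff.mpr ?_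
  obtain ⟨u', hu'⟩ := himprove u hu
  linarith [ciInf_le (hbdd p hp) u']

section TopSets

variable {n k : ℕ}

theorem mem_topSets_iff {u : Fin n → ℝ} {S : Report n k} :
    S ∈ topSets k u ↔ ∀ i ∈ S.1, ∀ j ∉ S.1, u j ≤ u i := by
  refine ⟨fun hS i hi j hj => ?_, fun h S' => sum_le_sum_of_card_eq (S'.2.trans S.2.symm) ?_⟩
  · have hj' : j ∉ S.1.erase i := fun hmem => hj (mem_of_mem_erase hmem)
    have hswap := hS ⟨insert j (S.1.erase i), by
      rw [card_insert_of_notMem hj', card_erase_add_one hi, S.2]⟩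
    rwa [sum_insert hj', ← add_sum_erase S.1 u hi, add_le_add_iff_right] at hswap
  · exact fun j hj i hi => h i (mem_sdiff.mp hi).1 j (mem_sdiff.mp hj).2

theorem expectedLoss_topKLoss (p : Fin n → ℝ) (S : Report n k) :
    expectedLoss topKLoss p S = ∑ y, p y - ∑ y ∈ S.1, p y := by
  rw [← sum_compl_add_sum S.1 p, add_sub_cancel_right]
  simp only [expectedLoss, topKLoss, mul_ite, mul_zero, mul_one, sum_ite, sum_const_zero, zero_add]
  rw [filter_notMem_eq_sdiff, compl_eq_univ_sdiff]

theorem prop_topKLoss (p : Fin n → ℝ) :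
    prop (topKLoss (k := k)) p = topSets k p := by
  simp only [prop, topSets, expectedLoss_topKLoss, sub_le_sub_iff_left]

theorem antitone_sortedDesc (u : Fin n → ℝ) : Antitone (sortedDesc u) :=
  fun _ _ hij => neg_le_neg_iff.mp (Tuple.monotone_sort (fun j => -u j) hij)

theorem exists_notMem_sortedDesc_le_of_notMem_topSets {p : Fin n → ℝ} {S : Report n k}
    (hS : S ∉ topSets k p) {m : Fin n} (hm : m.val + 1 = k) :
    ∃ i ∉ S.1, sortedDesc p m ≤ p i := by
  contrapose! hS
  set T : Finset (Fin n) := (Iic m).map (Tuple.sort fun j => -p j).toEmbedding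
  have hT : ∀ i ∈ T, sortedDesc p m ≤ p i := by
    intro i hi
    obtain ⟨l, hl, rfl⟩ := mem_map.mp hi
    exact antitone_sortedDesc p (mem_Iic.mp hl)
  have hTS : T = S.1 := by
    refine eq_of_subset_of_card_le (fun i hi => ?_) ?_
    · by_contra hiS
      exact (hS i hiS).not_ge (hT i hi)
    · rw [S.2, card_map, Fin.card_Iic, hm]
  exact mem_topSets_iff.mpr fun i hi j hj => (hS j hj).le.trans (hT i (hTS ▸ hi))

end TopSets

section Surrogate

variable {n : ℕ}

theorem isGreatest_sum_max_sortedDesc (k : ℕ) (c : ℝ) (v : Fin n → ℝ) :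
    IsGreatest ((fun S : Finset (Fin n) => ∑ j ∈ S, (c + v j)) '' {S | #S ≤ k})
      (∑ i with i.val < k, max (c + sortedDesc v i) 0) := by
  set σ := Tuple.sort fun j => -v j
  constructor
  · refine ⟨({i | i.val < k ∧ 0 ≤ c + sortedDesc v i} : Finset (Fin n)).map σ.toEmbedding, ?_, ?_⟩
    · rw [Set.mem_ofPred_eq, card_map, ← filter_filter]
      exact (card_filter_le _ _).trans (Fin.card_filter_val_lt.trans_le (min_le_right _ _))
    · simp only [sum_map, ← filter_filter]
      rw [sum_filter]
      refine sum_congr rfl fun i _ => ?_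
      split_ifs with h
      · exact (max_eq_left h).symm
      · exact (max_eq_right (not_le.mp h).le).symm
  · rintro _ ⟨S, hS, rfl⟩
    have hanti : Antitone fun i => max (c + sortedDesc v i) 0 := fun i j hij =>
      max_le_max_right _ (add_le_add_right (antitone_sortedDesc v hij) c)
    calc ∑ j ∈ S, (c + v j)
        ≤ ∑ j ∈ S, max (c + v j) 0 := sum_le_sum fun j _ => le_max_left _ _
      _ = ∑ i ∈ S.map σ.symm.toEmbedding, max (c + sortedDesc v i) 0 := by
          simp [sum_map, sortedDesc, σ]
      _ ≤ ∑ i with i.val < k, max (c + sortedDesc v i) 0 :=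
          sum_le_sum_val_lt_of_antitone hanti (fun _ => le_max_right _ _)
            ((card_map _).trans_le hS)

theorem mul_L3 (k : ℕ) (u : Fin n → ℝ) (y : Fin n) :
    k * L3 k u y = ∑ i with i.val < k, max (1 - u y + sortedDesc (u - Pi.single y 1) i) 0 := by
  rcases eq_or_ne k 0 with rfl | hk
  · simp
  · rw [L3, ← mul_assoc, mul_one_div_cancel (Nat.cast_ne_zero.mpr hk), one_mul]

theorem isGreatest_mul_L3 (k : ℕ) (u : Fin n → ℝ) (y : Fin n) :
    IsGreatest ((fun S : Finset (Fin n) => ∑ j ∈ S, (1 + u j - u y)) '' {S | y ∉ S ∧ #S ≤ k})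
      (k * L3 k u y) := by
  have hmargin : ∀ S : Finset (Fin n), y ∉ S → ∑ j ∈ S, (1 + u j - u y) =
      ∑ j ∈ S, (1 - u y + (u - Pi.single y 1 : Fin n → ℝ) j) := fun S hyS =>
    sum_congr rfl fun j hj => by
      rw [Pi.sub_apply, Pi.single_eq_of_ne (ne_of_mem_of_not_mem hj hyS)]
      ring
  rw [mul_L3]
  obtain ⟨⟨S, hS, hsum⟩, hub⟩ := isGreatest_sum_max_sortedDesc k (1 - u y) (u - Pi.single y 1)
  constructor
  · -- The summand at `y` vanishes because of the subtraction of `e_y`.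
    refine ⟨S.erase y, ⟨notMem_erase y S, card_erase_le.trans hS⟩, ?_⟩
    simp only [hmargin _ (notMem_erase y S), ← hsum]
    exact sum_erase _ (by simp)
  · rintro _ ⟨S, ⟨hyS, hS⟩, rfl⟩
    exact hub ⟨S, hS, (hmargin S hyS).symm⟩

theorem L3_nonneg (k : ℕ) (u : Fin n → ℝ) (y : Fin n) : 0 ≤ L3 k u y :=
  mul_nonneg (by positivity) (sum_nonneg fun _ _ => le_max_right _ _)

theorem bddBelow_range_expectedLoss_L3 (k : ℕ) {p : Fin n → ℝ} (hp : 0 ≤ p) :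
    BddBelow (Set.range (expectedLoss (L3 k) p)) := by
  refine ⟨0, ?_⟩
  rintro _ ⟨u, rfl⟩
  exact sum_nonneg fun y _ => mul_nonneg (hp y) (L3_nonneg k u y)

theorem mul_L3_add_single_le_of_ne (k : ℕ) (u : Fin n → ℝ) {i y : Fin n} (hyi : y ≠ i) :
    k * L3 k (u + Pi.single i 1) y ≤ k * L3 k u y + 1 := by
  obtain ⟨S, hS, hsum⟩ := (isGreatest_mul_L3 k (u + Pi.single i 1) y).1
  have hsingle : ∑ j ∈ S, (Pi.single i 1 : Fin n → ℝ) j ≤ 1 := by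
    rw [sum_pi_single']
    split_ifs <;> norm_num
  calc k * L3 k (u + Pi.single i 1) y
      = ∑ j ∈ S, (1 + u j - u y) + ∑ j ∈ S, (Pi.single i 1 : Fin n → ℝ) j := by
        rw [← hsum, ← sum_add_distrib]
        refine sum_congr rfl fun j _ => ?_
        simp only [Pi.add_apply, Pi.single_eq_of_ne hyi]
        ring
    _ ≤ k * L3 k u y + 1 := add_le_add ((isGreatest_mul_L3 k u y).2 ⟨S, hS, rfl⟩) hsingle

theorem mul_L3_add_single_self_add_le {k : ℕ} {u : Fin n → ℝ} {i : Fin n} {W : Report n k}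
    (hiW : i ∉ W.1) (hW : ∀ j ∈ W.1, u i ≤ u j) :
    k * L3 k (u + Pi.single i 1) i + k ≤ k * L3 k u i := by
  obtain ⟨S, ⟨hiS, hS⟩, hsum⟩ := (isGreatest_mul_L3 k (u + Pi.single i 1) i).1
  obtain ⟨S', hSS', hS'W, hS'⟩ := exists_subsuperset_card_eq
    (subset_union_left : S ⊆ S ∪ W.1) hS (W.2.ge.trans (card_le_card subset_union_right))
  have hiS' : i ∉ S' := fun hi => (mem_union.mp (hS'W hi)).elim hiS hiW
  calc k * L3 k (u + Pi.single i 1) i + k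
      = ∑ j ∈ S, (u j - u i) + k := by
        rw [← hsum]
        refine congrArg (· + (k : ℝ)) (sum_congr rfl fun j hj => ?_)
        rw [Pi.add_apply, Pi.add_apply, Pi.single_eq_same,
          Pi.single_eq_of_ne (ne_of_mem_of_not_mem hj hiS)]
        ring
    _ ≤ ∑ j ∈ S', (u j - u i) + k := by
        gcongr ?_ + _
        refine sum_le_sum_of_subset_of_nonneg hSS' fun j hj hjS => sub_nonneg.mpr (hW j ?_)
        exact (mem_union.mp (hS'W hj)).resolve_left hjS
    _ = ∑ j ∈ S', (1 + u j - u i) := by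
        simp only [add_sub_assoc, sum_add_distrib (f := fun _ => (1 : ℝ)), sum_const, hS',
          nsmul_one, add_comm (k : ℝ)]
    _ ≤ k * L3 k u i := (isGreatest_mul_L3 k u i).2 ⟨S', ⟨hiS', hS'.le⟩, rfl⟩

theorem mul_expectedLoss_L3_add_single_add_le {k : ℕ} {p u : Fin n → ℝ}
    (hp : p ∈ stdSimplex ℝ (Fin n)) {i : Fin n} {W : Report n k} (hiW : i ∉ W.1)
    (hW : ∀ j ∈ W.1, u i ≤ u j) :
    k * expectedLoss (L3 k) p (u + Pi.single i 1) + ((k + 1) * p i - 1) ≤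
      k * expectedLoss (L3 k) p u := by
  have hlabel : ∀ y, k * L3 k (u + Pi.single i 1) y + (k + 1) * (Pi.single i 1 : Fin n → ℝ) y - 1 ≤
      k * L3 k u y := by
    intro y
    rcases eq_or_ne y i with rfl | hyi
    · rw [Pi.single_eq_same]
      linarith [mul_L3_add_single_self_add_le hiW hW]
    · rw [Pi.single_eq_of_ne hyi]
      linarith [mul_L3_add_single_le_of_ne k u hyi]
  calc k * expectedLoss (L3 k) p (u + Pi.single i 1) + ((k + 1) * p i - 1)
      = ∑ y, p y * (k * L3 k (u + Pi.single i 1) y +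
          (k + 1) * (Pi.single i 1 : Fin n → ℝ) y - 1) := by
        simp only [expectedLoss, mul_sub, mul_add, sum_sub_distrib, sum_add_distrib, mul_one, hp.2,
          mul_sum, mul_left_comm (p _), Pi.single_apply, mul_ite, mul_zero, sum_ite_eq',
          mem_univ, if_true]
        ring
    _ ≤ ∑ y, p y * (k * L3 k u y) :=
        sum_le_sum fun y _ => mul_le_mul_of_nonneg_left (hlabel y) (hp.1 y)
    _ = k * expectedLoss (L3 k) p u := by
        simp only [expectedLoss, mul_sum, mul_left_comm]

end Surrogate

end TopK

theorem mainTheorem4 (n k : ℕ) (hk : 1 ≤ k) (hkn : k ≤ n)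
    (ψ : (Fin n → ℝ) → TopK.Report n k) (hψ : TopK.IsArgmaxLink ψ) :
    TopK.Calibrated (TopK.L3 k) ψ TopK.topKLoss (TopK.P3 n k hk hkn) := by
  refine TopK.calibrated_of_forall_exists_add_le
    (fun p hp => TopK.bddBelow_range_expectedLoss_L3 k hp.1.1) ?_
  rintro p ⟨hp, hq, -⟩
  set q := TopK.sortedDesc p ⟨k - 1, by omega⟩
  have hk₀ : (0 : ℝ) < k := by exact_mod_cast hk
  have hgap : 0 < (k + 1) * q - 1 := by
    rw [div_lt_iff₀' (by positivity)] at hq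
    linarith
  refine ⟨((k + 1) * q - 1) / k, div_pos hgap hk₀, fun u hu => ?_⟩
  rw [TopK.prop_topKLoss] at hu
  obtain ⟨i, hiS, hqi⟩ :=
    TopK.exists_notMem_sortedDesc_le_of_notMem_topSets hu (m := ⟨k - 1, by omega⟩)
      (Nat.sub_add_cancel hk)
  have hdrop := TopK.mul_expectedLoss_L3_add_single_add_le hp hiS fun j hj =>
    TopK.mem_topSets_iff.mp (hψ u) j hj i hiS
  refine ⟨u + Pi.single i 1, le_of_mul_le_mul_left ?_ hk₀⟩
  rw [mul_add, mul_div_cancel₀ _ hk₀.ne']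
  have hmono : (k + 1) * q ≤ (k + 1) * p i := by gcongr
  linarith
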